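/- A $C^{1+\mathrm{Lip}}$ unimodal map is a differentiable map $f:[0,1]\to[0,1]$ whose derivative is Lipschitz, which has exactly one critical point $c$ in $[0,1]$, with $c\in(0,1)$, and which is normalized by $f(c)=1$ and $f(1)=0$. The space of these maps carries the $C^1$ metric $\max(\sup|f-g|,\sup|f'-g'|)$. Such an $f$ is period quintupling renormalizable if $f^3(0)<f^8(0)$ and the interval $J=[f^3(0),f^8(0)]=[f^5(c),f^{10}(c)]$ contains $c$ in its interior, satisfies $f^5(J)\subset J$, and $J,f(J),\dots,f^4(J)$ are pairwise disjoint and lie on the line in the order $f^2(J)<J<f^3(J)<f^4(J)<f(J)$. (Numbering these intervals from left to right, the combinatorics is $I_2\to I_5\to I_1\to I_3\to I_4\to I_2$.) Its renormalization is $Rf=h^{-1}\circ f^5\circ h$, where $h:[0,1]\to J$ is the orientation reversing affine homeomorphism. Let $W$ be the set of period quintupling infinitely renormalizable maps, i.e. those $f$ for which every $R^nf$, $n\ge 0$, is a period quintupling renormalizable $C^{1+\mathrm{Lip}}$ unimodal map; thus $R:W\to W$. The topological entropy of $R$ is the supremum of $h_{\mathrm{top}}(R|_\Lambda)$ over all compact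 sets $\Lambda\subset W$ with $R(\Lambda)\subset\Lambda$. Theorem. The period quintupling renormalization operator $R$ on $C^{1+\mathrm{Lip}}$ unimodal maps has infinite topological entropy. Moreover, it has a continuum of fixed points: the set of fixed points of $R$ has the cardinality of the continuum, and there is an injective continuous map from $[0,1]$ into it. -/

import Mathlib

open Set Function
open scoped unitInterval NNReal Cardinal

namespace Quintupling

/-- The derivative of a self-map of `[0,1]`, one-sided at the two end points. -/
noncomputable def slope (f : I → I) (x : I) : ℝ :=
  derivWithin (IccExtend (zero_le_one (α := ℝ)) fun t => (f t : ℝ)) (Icc 0 1) x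

/-- `f : [0,1] → [0,1]` is a `C^{1+Lip}` unimodal map, in the usual normalization: it is
differentiable with Lipschitz derivative, it has exactly one critical point `c`, which lies in
`(0,1)`, and `f c = 1`, `f 1 = 0`. (So `f` increases on `[0,c]` and decreases on `[c,1]`.) -/
structure IsC1LipUnimodal (f : I → I) : Prop where
  differentiable :
    DifferentiableOn ℝ (IccExtend (zero_le_one (α := ℝ)) fun t => (f t : ℝ)) (Icc 0 1)
  lipschitz : ∃ K : ℝ≥0, LipschitzWith K (slope f)
  critical : ∃ c : I, 0 < c ∧ c < 1 ∧ f c = 1 ∧ ∀ x, slope f x = 0 ↔ x = c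
  map_one : f 1 = 0

/-- The space of `C^{1+Lip}` unimodal maps of `[0,1]`. -/
@[ext]
structure UnimodalMap where
  toFun : I → I
  isUnimodal : IsC1LipUnimodal toFun

lemma IsC1LipUnimodal.continuous_coe {f : I → I} (hf : IsC1LipUnimodal f) :
    Continuous fun x => (f x : ℝ) := by
  have h := continuousOn_iff_continuous_domRestrict.1 hf.differentiable.continuousOn
  convert h using 1
  ext x
  simp [IccExtend_of_mem]

lemma IsC1LipUnimodal.continuous_slope {f : I → I} (hf : IsC1LipUnimodal f) :
    Continuous (slope f) := by
  obtain ⟨K, hK⟩ := hf.lipschitz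
  exact hK.continuous

/-- A map together with its derivative, as a pair of continuous functions. -/
noncomputable def UnimodalMap.jet (f : UnimodalMap) : C(I, ℝ) × C(I, ℝ) :=
  (⟨fun x => (f.toFun x : ℝ), f.isUnimodal.continuous_coe⟩,
    ⟨slope f.toFun, f.isUnimodal.continuous_slope⟩)

lemma UnimodalMap.jet_injective : Injective UnimodalMap.jet := by
  intro f g h
  ext x
  exact DFunLike.congr_fun (congrArg Prod.fst h) x

/-- The `C^1` metric `d(f,g) = max (sup |f - g|) (sup |f' - g'|)`. -/
noncomputable instance : MetricSpace UnimodalMap :=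
  MetricSpace.induced UnimodalMap.jet UnimodalMap.jet_injective inferInstance

/-- The return interval `J = [f³(0), f⁸(0)]`. Since `f c = 1` and `f 1 = 0`, this is
`[f⁵(c), f¹⁰(c)]`, the only interval for which the rescaled fifth iterate is again normalized. -/
def returnInterval (f : I → I) : Set I := Icc (f^[3] 0) (f^[8] 0)

/-- The set `A` lies strictly to the left of the set `B`. -/
def Before (A B : Set I) : Prop := ∀ x ∈ A, ∀ y ∈ B, x < y

/-- `f` is period quintupling renormalizable: `J` is a nondegenerate interval around the critical
point, it is mapped into itself by `f⁵`, and `J, f(J), f²(J), f³(J), f⁴(J)` are pairwise disjoint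
and lie on the line in the order `f²(J) < J < f³(J) < f⁴(J) < f(J)`. Numbering the five intervals
from left to right, the combinatorics is `I₂ → I₅ → I₁ → I₃ → I₄ → I₂`. -/
structure IsQuintRenormalizable (f : I → I) : Prop where
  nondegenerate : f^[3] 0 < f^[8] 0
  critical_mem : ∃ c ∈ Ioo (f^[3] 0) (f^[8] 0), slope f c = 0
  mapsTo : MapsTo f^[5] (returnInterval f) (returnInterval f)
  order₁₂ : Before (f^[2] '' returnInterval f) (returnInterval f)
  order₂₃ : Before (returnInterval f) (f^[3] '' returnInterval f)
  order₃₄ : Before (f^[3] '' returnInterval f) (f^[4] '' returnInterval f)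
  order₄₅ : Before (f^[4] '' returnInterval f) (f '' returnInterval f)

/-- The orientation reversing affine map `h` with `h 0 = f⁸(0)` and `h 1 = f³(0)`; it is a
homeomorphism of `[0,1]` onto `J` if `f³(0) < f⁸(0)`. -/
noncomputable def rescale (f : I → I) (t : ℝ) : ℝ :=
  (f^[8] 0 : I) - t * ((f^[8] 0 : I) - (f^[3] 0 : I))

/-- The inverse `y ↦ (f⁸(0) - y) / (f⁸(0) - f³(0))` of `h`. -/
noncomputable def unscale (f : I → I) (y : ℝ) : ℝ :=
  ((f^[8] 0 : I) - y) / ((f^[8] 0 : I) - (f^[3] 0 : I))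

/-- The renormalization `R f = h⁻¹ ∘ f⁵ ∘ h` of `f`. The two projections to `[0,1]` only serve to
make this a total function; they change nothing if `f` is period quintupling renormalizable. -/
noncomputable def renormalize (f : I → I) : I → I := fun t =>
  projIcc 0 1 zero_le_one
    (unscale f (f^[5] (projIcc 0 1 zero_le_one (rescale f t))))

/-- The period quintupling infinitely renormalizable `C^{1+Lip}` unimodal maps: the maps on which
all iterates of the renormalization operator are defined, i.e. all `Rⁿ f` are renormalizable
`C^{1+Lip}` unimodal maps. The metric is that of `UnimodalMap`. -/
abbrev InfRenormalizable : Type :=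
  {f : UnimodalMap // ∀ n : ℕ, IsC1LipUnimodal (renormalize^[n] f.toFun) ∧
    IsQuintRenormalizable (renormalize^[n] f.toFun)}

/-- The period quintupling renormalization operator. -/
noncomputable def renorm (f : InfRenormalizable) : InfRenormalizable :=
  ⟨⟨renormalize f.1.toFun, (f.2 1).1⟩, fun n => f.2 (n + 1)⟩

/-- The topological entropy of the renormalization operator: the supremum of the topological
entropies of its restrictions to compact invariant sets. -/
noncomputable def renormEntropy : EReal :=
  ⨆ (Λ : Set InfRenormalizable) (_ : IsCompact Λ) (_ : MapsTo renorm Λ Λ),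
    Dynamics.coverEntropy renorm Λ

end Quintupling

namespace Quintupling

/-! The full shift on `[0,1]^ℕ` embeds continuously in the renormalization dynamics. Put `J = [1/5,
2/5]` and `h x = 2/5 - x/5`, whose fixed point `1/3` is the critical point. The parabola `1 - 9/4 (x
- 1/3)²` is scaled by `h`, with factor `1/25` below its maximum. It is modified on `[0,1] \ J` so as
to be affine on intervals containing the next four images of `J`, with slopes `-3`, `3/2`, `-1/18`,
`-20`; their product `-5` turns the factor `1/25` into the slope `-1/5` of `h`. The same
modification is repeated inside `J`, `h(J)`, ... at all scales (`graph`).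

In the gap between the third and fourth images of `J` a bump of free height `ω n` is added at scale
`n`. No image of `J` meets the gap, so renormalizing only deletes `ω 0` (`template_orbit`,
`renormalize_template`). Scaling preserves second derivatives, so they stay bounded but need not
converge at `1/3`: this freedom is available in `C^{1+Lip}`.

A shift whose alphabet is an interval has infinite entropy (`log_le_coverEntropy`), and its constant
sequences give the fixed points. -/

/-! ### Quadratic splines -/

/-- The quadratic spline `∑ a (x - k)₊²` over the pairs `(a, k)` in a list. -/
noncomputable def spline (L : List (ℝ × ℝ)) (x : ℝ) : ℝ :=
  (L.map fun p => p.1 * max (x - p.2) 0 ^ 2).sum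

/-- The derivative of `spline L`. -/
noncomputable def splineDeriv (L : List (ℝ × ℝ)) (x : ℝ) : ℝ :=
  (L.map fun p => p.1 * (2 * max (x - p.2) 0)).sum

lemma max_sub_eq_sub {x k : ℝ} (h : k ≤ x) : max (x - k) 0 = x - k := max_eq_left (sub_nonneg.2 h)

lemma max_sub_eq_zero {x k : ℝ} (h : x ≤ k) : max (x - k) 0 = 0 := max_eq_right (sub_nonpos.2 h)

lemma hasDerivAt_of_abs_sub_le {f : ℝ → ℝ} {a x C : ℝ}
    (h : ∀ y, |f y - f x - (y - x) * a| ≤ C * (y - x) ^ 2) : HasDerivAt f a x := by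
  rw [hasDerivAt_iff_isLittleO]
  refine Asymptotics.IsBigO.trans_isLittleO (g := fun y => (y - x) ^ 2) ?_ ?_
  · refine Asymptotics.IsBigO.of_bound C (Filter.Eventually.of_forall fun y => ?_)
    simpa [smul_eq_mul] using h y
  · have := (Asymptotics.isLittleO_pow_id (𝕜 := ℝ) (n := 2) one_lt_two)
    refine (this.comp_tendsto (k := fun y => y - x) (l' := nhds x) ?_).congr_left fun _ => rfl
    exact (continuous_id.sub continuous_const).tendsto' x 0 (by simp)

lemma hasDerivAt_max_zero_sq (x : ℝ) :
    HasDerivAt (fun y : ℝ => max y 0 ^ 2) (2 * max x 0) x := by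
  refine hasDerivAt_of_abs_sub_le (C := 1) fun y => ?_
  rw [abs_le]
  rcases le_total x 0 with hx | hx <;> rcases le_total y 0 with hy | hy <;>
    simp only [hx, hy, max_eq_left, max_eq_right] <;> constructor <;> nlinarith

lemma hasDerivAt_spline (L : List (ℝ × ℝ)) (x : ℝ) :
    HasDerivAt (spline L) (splineDeriv L x) x := by
  induction L with
  | nil => exact hasDerivAt_const x (0 : ℝ)
  | cons p L ih =>
    have h := ((hasDerivAt_max_zero_sq (x - p.2)).comp x
      ((hasDerivAt_id x).sub_const p.2)).const_mul p.1
    exact ((h.add ih).congr_deriv (by simp [splineDeriv])).congr_of_eventuallyEq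
      (Filter.Eventually.of_forall fun y => by simp [spline])

lemma abs_splineDeriv_sub_le (L : List (ℝ × ℝ)) :
    ∃ K, 0 ≤ K ∧ ∀ x y, |splineDeriv L x - splineDeriv L y| ≤ K * |x - y| := by
  induction L with
  | nil => exact ⟨0, le_rfl, fun x y => by simp [splineDeriv]⟩
  | cons p L ih =>
    obtain ⟨K, hK, h⟩ := ih
    refine ⟨2 * |p.1| + K, by positivity, fun x y => ?_⟩
    have h1 : |max (x - p.2) 0 - max (y - p.2) 0| ≤ |x - y| := by
      simpa using abs_max_sub_max_le_abs (x - p.2) (y - p.2) 0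
    have e : splineDeriv (p :: L) x - splineDeriv (p :: L) y =
        2 * p.1 * (max (x - p.2) 0 - max (y - p.2) 0) + (splineDeriv L x - splineDeriv L y) := by
      simp [splineDeriv]; ring
    rw [e, add_mul]
    refine (abs_add_le _ _).trans (add_le_add ?_ (h x y))
    rw [abs_mul, abs_mul, abs_two]
    exact mul_le_mul_of_nonneg_left h1 (by positivity)

/-! ### The modification at a single scale -/

/-- The deviation of the template from the parabola `1 - 9/4 (x - 1/3)²`. -/
noncomputable def base : List (ℝ × ℝ) :=
  [(9/4, 0), (-585/8, 3/25), (540/7, 13/100), (-351/56, 1/5), (5225/1764, 2/5),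
    (-320/441, 23/40), (2/147, 3/4), (-29375/3, 93/100), (158300/9, 187/200),
    (-70175/9, 47/50), (1550, 19/20), (-1400, 191/200), (-150, 24/25), (-9/4, 1)]

/-- A perturbation of the template, supported in the gap `[93/100, 94/100]`. -/
noncomputable def bump : List (ℝ × ℝ) :=
  [(1, 93/100), (-2, 373/400), (2, 15/16), (-1, 47/50)]

lemma spline_base_of_le {x : ℝ} (hx : x ≤ 0) : spline base x = 0 := by
  simp (disch := grind) only [spline, base, List.map, List.sum_cons, List.sum_nil,
    max_sub_eq_zero]
  ring

lemma spline_base_of_ge {x : ℝ} (hx : 1 ≤ x) : spline base x = 0 := by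
  simp (disch := grind) only [spline, base, List.map, List.sum_cons, List.sum_nil,
    max_sub_eq_sub]
  ring

lemma spline_base_of_mem {x : ℝ} (hx : x ∈ Icc (1/5 : ℝ) (2/5)) : spline base x = 0 := by
  obtain ⟨h1, h2⟩ := hx
  simp (disch := grind) only [spline, base, List.map, List.sum_cons, List.sum_nil,
    max_sub_eq_sub, max_sub_eq_zero]
  ring

lemma splineDeriv_base_of_le {x : ℝ} (hx : x ≤ 0) : splineDeriv base x = 0 := by
  simp (disch := grind) only [splineDeriv, base, List.map, List.sum_cons, List.sum_nil,
    max_sub_eq_zero]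
  ring

lemma splineDeriv_base_of_ge {x : ℝ} (hx : 1 ≤ x) : splineDeriv base x = 0 := by
  simp (disch := grind) only [splineDeriv, base, List.map, List.sum_cons, List.sum_nil,
    max_sub_eq_sub]
  ring

lemma splineDeriv_base_of_mem {x : ℝ} (hx : x ∈ Icc (1/5 : ℝ) (2/5)) :
    splineDeriv base x = 0 := by
  obtain ⟨h1, h2⟩ := hx
  simp (disch := grind) only [splineDeriv, base, List.map, List.sum_cons, List.sum_nil,
    max_sub_eq_sub, max_sub_eq_zero]
  ring

lemma spline_bump_of_le {x : ℝ} (hx : x ≤ 93/100) : spline bump x = 0 := by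
  simp (disch := grind) only [spline, bump, List.map, List.sum_cons, List.sum_nil,
    max_sub_eq_zero]
  ring

lemma spline_bump_of_ge {x : ℝ} (hx : 47/50 ≤ x) : spline bump x = 0 := by
  simp (disch := grind) only [spline, bump, List.map, List.sum_cons, List.sum_nil,
    max_sub_eq_sub]
  ring

lemma splineDeriv_bump_of_le {x : ℝ} (hx : x ≤ 93/100) : splineDeriv bump x = 0 := by
  simp (disch := grind) only [splineDeriv, bump, List.map, List.sum_cons, List.sum_nil,
    max_sub_eq_zero]
  ring

lemma splineDeriv_bump_of_ge {x : ℝ} (hx : 47/50 ≤ x) : splineDeriv bump x = 0 := by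
  simp (disch := grind) only [splineDeriv, bump, List.map, List.sum_cons, List.sum_nil,
    max_sub_eq_sub]
  ring

/-- The extrema `±1/200` occur at the knots `373/400` and `15/16`. They are smaller than the margin
`1/100` in `splineDeriv_base_left` and `splineDeriv_base_right`, so the bump creates no critical
point. -/
lemma abs_splineDeriv_bump_le (x : ℝ) : |splineDeriv bump x| ≤ 1/200 := by
  rw [abs_le]
  simp only [splineDeriv, bump, List.map, List.sum_cons, List.sum_nil]
  rcases le_total x (93/100) with h | h
  · simp (disch := grind) only [max_sub_eq_zero]
    constructor <;> linarith
  rcases le_total x (373/400) with h1 | h1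
  · simp (disch := grind) only [max_sub_eq_sub, max_sub_eq_zero]
    constructor <;> linarith
  rcases le_total x (15/16) with h2 | h2
  · simp (disch := grind) only [max_sub_eq_sub, max_sub_eq_zero]
    constructor <;> linarith
  rcases le_total x (47/50) with h3 | h3
  · simp (disch := grind) only [max_sub_eq_sub, max_sub_eq_zero]
    constructor <;> linarith
  · simp (disch := grind) only [max_sub_eq_sub]
    constructor <;> linarith

/-- The derivative is affine between consecutive knots, so each case is a linear inequality. -/
lemma splineDeriv_base_left {x : ℝ} (h0 : 0 ≤ x) (h1 : x ≤ 1/5) :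
    1/100 ≤ -9/2 * (x - 1/3) + splineDeriv base x := by
  simp only [splineDeriv, base, List.map, List.sum_cons, List.sum_nil]
  rcases le_total x (3/25) with h2 | h2
  · simp (disch := grind) only [max_sub_eq_sub, max_sub_eq_zero]
    linarith
  rcases le_total x (13/100) with h3 | h3
  · simp (disch := grind) only [max_sub_eq_sub, max_sub_eq_zero]
    linarith
  · simp (disch := grind) only [max_sub_eq_sub, max_sub_eq_zero]
    linarith

lemma splineDeriv_base_right {x : ℝ} (h0 : 2/5 ≤ x) (h1 : x ≤ 1) :
    -9/2 * (x - 1/3) + splineDeriv base x ≤ -1/100 := by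
  simp only [splineDeriv, base, List.map, List.sum_cons, List.sum_nil]
  rcases le_total x (23/40) with h2 | h2
  · simp (disch := grind) only [max_sub_eq_sub, max_sub_eq_zero]
    linarith
  rcases le_total x (3/4) with h3 | h3
  · simp (disch := grind) only [max_sub_eq_sub, max_sub_eq_zero]
    linarith
  rcases le_total x (93/100) with h4 | h4
  · simp (disch := grind) only [max_sub_eq_sub, max_sub_eq_zero]
    linarith
  rcases le_total x (187/200) with h5 | h5
  · simp (disch := grind) only [max_sub_eq_sub, max_sub_eq_zero]
    linarith
  rcases le_total x (47/50) with h6 | h6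
  · simp (disch := grind) only [max_sub_eq_sub, max_sub_eq_zero]
    linarith
  rcases le_total x (19/20) with h7 | h7
  · simp (disch := grind) only [max_sub_eq_sub, max_sub_eq_zero]
    linarith
  rcases le_total x (191/200) with h8 | h8
  · simp (disch := grind) only [max_sub_eq_sub, max_sub_eq_zero]
    linarith
  rcases le_total x (24/25) with h9 | h9
  · simp (disch := grind) only [max_sub_eq_sub, max_sub_eq_zero]
    linarith
  · simp (disch := grind) only [max_sub_eq_sub, max_sub_eq_zero]
    linarith

/-- The deviation from the parabola, with the bump of height `t` added. -/
noncomputable def profile (t x : ℝ) : ℝ := spline base x + t * spline bump x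

/-- The derivative of `profile t`. -/
noncomputable def profileDeriv (t x : ℝ) : ℝ := splineDeriv base x + t * splineDeriv bump x

lemma hasDerivAt_profile (t x : ℝ) : HasDerivAt (profile t) (profileDeriv t x) x :=
  (hasDerivAt_spline base x).add ((hasDerivAt_spline bump x).const_mul t)

lemma profile_eq_zero (t : ℝ) {x : ℝ} (hx : x ≤ 0 ∨ 1 ≤ x ∨ x ∈ Icc (1/5 : ℝ) (2/5)) :
    profile t x = 0 := by
  rcases hx with h | h | h
  · rw [profile, spline_base_of_le h, spline_bump_of_le (by linarith)]; ring
  · rw [profile, spline_base_of_ge h, spline_bump_of_ge (by linarith)]; ring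
  · rw [profile, spline_base_of_mem h, spline_bump_of_le (by linarith [h.2])]; ring

lemma profileDeriv_eq_zero (t : ℝ) {x : ℝ} (hx : x ≤ 0 ∨ 1 ≤ x ∨ x ∈ Icc (1/5 : ℝ) (2/5)) :
    profileDeriv t x = 0 := by
  rcases hx with h | h | h
  · rw [profileDeriv, splineDeriv_base_of_le h, splineDeriv_bump_of_le (by linarith)]; ring
  · rw [profileDeriv, splineDeriv_base_of_ge h, splineDeriv_bump_of_ge (by linarith)]; ring
  · rw [profileDeriv, splineDeriv_base_of_mem h, splineDeriv_bump_of_le (by linarith [h.2])]; ring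

lemma continuous_spline (L : List (ℝ × ℝ)) : Continuous (spline L) :=
  continuous_iff_continuousAt.2 fun x => (hasDerivAt_spline L x).continuousAt

lemma continuous_splineDeriv (L : List (ℝ × ℝ)) : Continuous (splineDeriv L) := by
  unfold splineDeriv
  fun_prop

lemma continuous_profile : Continuous fun p : ℝ × ℝ => profile p.1 p.2 :=
  ((continuous_spline _).comp continuous_snd).add
    (continuous_fst.mul ((continuous_spline _).comp continuous_snd))

lemma continuous_profileDeriv : Continuous fun p : ℝ × ℝ => profileDeriv p.1 p.2 :=
  ((continuous_splineDeriv _).comp continuous_snd).add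
    (continuous_fst.mul ((continuous_splineDeriv _).comp continuous_snd))

lemma abs_profileDeriv_sub_le :
    ∃ K, 0 ≤ K ∧ ∀ (t : I) (x y : ℝ), |profileDeriv t x - profileDeriv t y| ≤ K * |x - y| := by
  obtain ⟨K, hK, h⟩ := abs_splineDeriv_sub_le base
  obtain ⟨K', hK', h'⟩ := abs_splineDeriv_sub_le bump
  refine ⟨K + K', by positivity, fun t x y => ?_⟩
  have e : profileDeriv t x - profileDeriv t y = (splineDeriv base x - splineDeriv base y) +
      t * (splineDeriv bump x - splineDeriv bump y) := by
    simp only [profileDeriv]; ring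
  rw [e, add_mul]
  refine (abs_add_le _ _).trans (add_le_add (h x y) ?_)
  rw [abs_mul, abs_of_nonneg t.2.1]
  exact (mul_le_of_le_one_left (abs_nonneg _) t.2.2).trans (h' x y)

/-- A continuous function that vanishes off a compact set of the second variable is bounded. -/
lemma exists_bound {u : ℝ → ℝ → ℝ} (hu : Continuous fun p : ℝ × ℝ => u p.1 p.2)
    (h0 : ∀ t x, x ≤ 0 ∨ 1 ≤ x → u t x = 0) : ∃ M, ∀ (t : I) (x : ℝ), |u t x| ≤ M := by
  obtain ⟨M, hM⟩ := (isCompact_Icc.prod isCompact_Icc :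
    IsCompact (Icc (0 : ℝ) 1 ×ˢ Icc (0 : ℝ) 1)).exists_bound_of_continuousOn hu.continuousOn
  refine ⟨M, fun t x => ?_⟩
  by_cases hx : x ∈ Icc (0 : ℝ) 1
  · exact hM (t, x) ⟨t.2, hx⟩
  · rw [h0 t x ?_, abs_zero]
    · exact (norm_nonneg _).trans (hM (0, 0) (by simp))
    · by_contra! h
      exact hx ⟨h.1.le, h.2.le⟩

lemma abs_profile_le : ∃ M, ∀ (t : I) (x : ℝ), |profile t x| ≤ M :=
  exists_bound continuous_profile fun t _ h => profile_eq_zero t (by tauto)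

lemma abs_profileDeriv_le : ∃ M, ∀ (t : I) (x : ℝ), |profileDeriv t x| ≤ M :=
  exists_bound continuous_profileDeriv fun t _ h => profileDeriv_eq_zero t (by tauto)

/-! ### Superposition of all scales -/

/-- The `n`-th iterate of the inverse of the affine map `x ↦ 2/5 - x/5`. -/
noncomputable def zoom (n : ℕ) (x : ℝ) : ℝ := 1/3 + (-5) ^ n * (x - 1/3)

lemma zoom_zero (x : ℝ) : zoom 0 x = x := by simp [zoom]

lemma zoom_succ (n : ℕ) (x : ℝ) : zoom (n + 1) x = 2 - 5 * zoom n x := by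
  simp only [zoom, pow_succ]; ring

lemma zoom_succ_shrink (n : ℕ) (x : ℝ) : zoom (n + 1) (2/5 - x/5) = zoom n x := by
  simp only [zoom, pow_succ]; ring

lemma zoom_add (m n : ℕ) (x : ℝ) : zoom (m + n) x = zoom m (zoom n x) := by
  simp only [zoom, pow_add]; ring

/-- The map `x ↦ 2 - 5x` sends the complement of `J` out of `[0,1]`, and nothing outside `(0,1)`
ever returns. Hence different scales have disjoint supports. -/
lemma zoom_escape {x : ℝ} (hx : x ≤ 1/5 ∨ 2/5 ≤ x) (n : ℕ) :
    zoom (n + 1) x ≤ 0 ∨ 1 ≤ zoom (n + 1) x := by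
  induction n with
  | zero =>
    rw [zoom_succ, zoom_zero]
    rcases hx with h | h
    · right; linarith
    · left; linarith
  | succ n ih =>
    rw [zoom_succ]
    rcases ih with h | h
    · right; linarith
    · left; linarith

/-- The unimodal map with the sequence `ω` of bump heights. -/
noncomputable def graph (ω : ℕ → I) (x : ℝ) : ℝ :=
  1 - 9/4 * (x - 1/3) ^ 2 + ∑' n, (1/25) ^ n * profile (ω n) (zoom n x)

/-- The derivative of `graph ω`. -/
noncomputable def graphDeriv (ω : ℕ → I) (x : ℝ) : ℝ :=
  -9/2 * (x - 1/3) + ∑' n, (-1/5) ^ n * profileDeriv (ω n) (zoom n x)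

/-- One majorant, uniform in `ω`, serves the M-test for termwise differentiation and for continuity
in `ω`. -/
lemma norm_term_le : ∃ u : ℕ → ℝ, Summable u ∧
    (∀ (ω : ℕ → I) n x, ‖(1/25) ^ n * profile (ω n) (zoom n x)‖ ≤ u n) ∧
    (∀ (ω : ℕ → I) n x, ‖(-1/5) ^ n * profileDeriv (ω n) (zoom n x)‖ ≤ u n) := by
  obtain ⟨M, hM⟩ := abs_profile_le
  obtain ⟨M', hM'⟩ := abs_profileDeriv_le
  refine ⟨fun n => (1/5) ^ n * max M M', (summable_geometric_of_lt_one (by norm_num)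
    (by norm_num)).mul_right _, fun ω n x => ?_, fun ω n x => ?_⟩
  · rw [norm_mul, norm_pow]
    refine mul_le_mul (pow_le_pow_left₀ (norm_nonneg _) ?_ n) ((hM _ _).trans (le_max_left _ _))
      (norm_nonneg _) (by positivity)
    norm_num
  · rw [norm_mul, norm_pow]
    refine mul_le_mul (pow_le_pow_left₀ (norm_nonneg _) ?_ n) ((hM' _ _).trans (le_max_right _ _))
      (norm_nonneg _) (by positivity)
    norm_num

lemma continuous_graph : Continuous fun p : (ℕ → I) × ℝ => graph p.1 p.2 := by
  obtain ⟨u, hu, h, -⟩ := norm_term_le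
  refine Continuous.add (by fun_prop) (continuous_tsum (fun n => ?_) hu fun n p => h p.1 n p.2)
  refine continuous_const.mul (continuous_profile.comp (Continuous.prodMk ?_ ?_))
  · fun_prop
  · fun_prop

lemma continuous_graphDeriv : Continuous fun p : (ℕ → I) × ℝ => graphDeriv p.1 p.2 := by
  obtain ⟨u, hu, -, h⟩ := norm_term_le
  refine Continuous.add (by fun_prop) (continuous_tsum (fun n => ?_) hu fun n p => h p.1 n p.2)
  refine continuous_const.mul (continuous_profileDeriv.comp (Continuous.prodMk ?_ ?_))
  · fun_prop
  · fun_prop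

lemma hasDerivAt_graph (ω : ℕ → I) (x : ℝ) : HasDerivAt (graph ω) (graphDeriv ω x) x := by
  obtain ⟨u, hu, h, h'⟩ := norm_term_le
  have h1 : HasDerivAt (fun x : ℝ => 1 - 9/4 * (x - 1/3) ^ 2) (-9/2 * (x - 1/3)) x := by
    have := ((((hasDerivAt_id x).sub_const (1/3)).pow 2).const_mul (9/4)).const_sub 1
    exact this.congr_deriv (by simp; ring)
  refine h1.add (hasDerivAt_tsum hu (fun n y => ?_) (fun n y => h' ω n y)
    (hu.of_norm_bounded (fun n => h ω n 0)) x)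
  have hz : HasDerivAt (zoom n) ((-5) ^ n) y := by
    have := (((hasDerivAt_id y).sub_const (1/3)).const_mul ((-5 : ℝ) ^ n)).const_add (1/3)
    exact this.congr_deriv (by simp)
  have := ((hasDerivAt_profile (ω n) (zoom n y)).comp y hz).const_mul ((1/25) ^ n)
  refine this.congr_deriv ?_
  have e : (-1/5 : ℝ) ^ n = (1/25) ^ n * (-5) ^ n := by rw [← mul_pow]; norm_num
  rw [e]; ring

lemma graph_eq_profile (ω : ℕ → I) {x : ℝ} (hx : x ≤ 1/5 ∨ 2/5 ≤ x) :
    graph ω x = 1 - 9/4 * (x - 1/3) ^ 2 + profile (ω 0) x := by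
  rw [graph, tsum_eq_single 0]
  · simp [zoom_zero]
  · intro n hn
    obtain ⟨m, rfl⟩ := Nat.exists_eq_succ_of_ne_zero hn
    have := zoom_escape hx m
    rw [profile_eq_zero _ (by tauto), mul_zero]

lemma graphDeriv_eq_profileDeriv (ω : ℕ → I) {x : ℝ} (hx : x ≤ 1/5 ∨ 2/5 ≤ x) :
    graphDeriv ω x = -9/2 * (x - 1/3) + profileDeriv (ω 0) x := by
  rw [graphDeriv, tsum_eq_single 0]
  · simp [zoom_zero]
  · intro n hn
    obtain ⟨m, rfl⟩ := Nat.exists_eq_succ_of_ne_zero hn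
    have := zoom_escape hx m
    rw [profileDeriv_eq_zero _ (by tauto), mul_zero]

/-- The shift on sequences. -/
def shift (ω : ℕ → I) : ℕ → I := fun n => ω (n + 1)

/-- On `J` the term of scale `0` vanishes; reindexing the others brings out a factor `1/25`, which
is also the scaling factor of the parabola. -/
lemma graph_shrink (ω : ℕ → I) {x : ℝ} (hx : x ∈ Icc (0 : ℝ) 1) :
    graph ω (2/5 - x/5) = 1 - (1 - graph (shift ω) x) / 25 := by
  obtain ⟨u, hu, h, -⟩ := norm_term_le
  rw [graph, graph, (hu.of_norm_bounded (fun n => h ω n _)).tsum_eq_zero_add, zoom_zero,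
    profile_eq_zero _ (Or.inr (Or.inr ⟨by linarith [hx.2], by linarith [hx.1]⟩))]
  have : ∀ n, (1/25 : ℝ) ^ (n + 1) * profile (ω (n + 1)) (zoom (n + 1) (2/5 - x/5)) =
      (1/25) * ((1/25) ^ n * profile (shift ω n) (zoom n x)) := fun n => by
    rw [zoom_succ_shrink, shift, pow_succ]; ring
  simp only [this, tsum_mul_left]
  ring

lemma graphDeriv_shrink (ω : ℕ → I) {x : ℝ} (hx : x ∈ Icc (0 : ℝ) 1) :
    graphDeriv ω (2/5 - x/5) = -graphDeriv (shift ω) x / 5 := by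
  obtain ⟨u, hu, -, h⟩ := norm_term_le
  rw [graphDeriv, graphDeriv, (hu.of_norm_bounded (fun n => h ω n _)).tsum_eq_zero_add, zoom_zero,
    profileDeriv_eq_zero _ (Or.inr (Or.inr ⟨by linarith [hx.2], by linarith [hx.1]⟩))]
  have : ∀ n, (-1/5 : ℝ) ^ (n + 1) * profileDeriv (ω (n + 1)) (zoom (n + 1) (2/5 - x/5)) =
      (-1/5) * ((-1/5) ^ n * profileDeriv (shift ω n) (zoom n x)) := fun n => by
    rw [zoom_succ_shrink, shift, pow_succ]; ring
  simp only [this, tsum_mul_left]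
  ring

/-! ### Lipschitz derivative and unimodality -/

/-- A sum of functions with a common Lipschitz constant and disjoint supports is Lipschitz. -/
lemma abs_tsum_sub_tsum_le {d : ℕ → ℝ → ℝ} {K : ℝ}
    (hK : ∀ n x y, |d n x - d n y| ≤ K * |x - y|)
    (hd : ∀ x, ∃ i, ∀ n, n ≠ i → d n x = 0) (x y : ℝ) :
    |∑' n, d n x - ∑' n, d n y| ≤ 2 * K * |x - y| := by
  obtain ⟨i, hi⟩ := hd x
  obtain ⟨j, hj⟩ := hd y
  have h0 : 0 ≤ K * |x - y| := (abs_nonneg _).trans (hK 0 x y)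
  rw [tsum_eq_sum (s := {i, j}) (fun n hn => hi n (by aesop)),
    tsum_eq_sum (s := {i, j}) (fun n hn => hj n (by aesop)), ← Finset.sum_sub_distrib]
  refine (Finset.abs_sum_le_sum_abs _ _).trans
    ((Finset.sum_le_card_nsmul _ _ _ fun n _ => hK n x y).trans ?_)
  rw [nsmul_eq_mul, mul_assoc]
  exact mul_le_mul_of_nonneg_right (by exact_mod_cast Finset.card_le_two) h0

lemma abs_graphDeriv_sub_le (ω : ℕ → I) :
    ∃ K, 0 ≤ K ∧ ∀ x y, |graphDeriv ω x - graphDeriv ω y| ≤ K * |x - y| := by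
  obtain ⟨K, hK, h⟩ := abs_profileDeriv_sub_le
  refine ⟨9/2 + 2 * K, by positivity, fun x y => ?_⟩
  have key := abs_tsum_sub_tsum_le (K := K)
    (d := fun n x => (-1/5) ^ n * profileDeriv (ω n) (zoom n x)) ?_ ?_ x y
  · have e : graphDeriv ω x - graphDeriv ω y = -9/2 * (x - y) +
        (∑' n, (-1/5) ^ n * profileDeriv (ω n) (zoom n x) -
          ∑' n, (-1/5) ^ n * profileDeriv (ω n) (zoom n y)) := by
      simp only [graphDeriv]; ring
    rw [e, add_mul]
    refine (abs_add_le _ _).trans (add_le_add ?_ key)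
    rw [abs_mul]; norm_num
  · intro n x y
    rw [← mul_sub, abs_mul]
    have hz : |zoom n x - zoom n y| = 5 ^ n * |x - y| := by
      have : zoom n x - zoom n y = (-5) ^ n * (x - y) := by simp only [zoom]; ring
      rw [this, abs_mul, abs_pow]; norm_num
    have h1 := h (ω n) (zoom n x) (zoom n y)
    rw [hz] at h1
    refine (mul_le_mul_of_nonneg_left h1 (abs_nonneg _)).trans (le_of_eq ?_)
    -- The amplitude `5⁻ⁿ` cancels the expansion `5ⁿ`: the Lipschitz constant is the same at every
    -- scale, so only disjointness of supports controls the sum.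
    have : |(-1/5 : ℝ) ^ n| * 5 ^ n = 1 := by
      rw [abs_pow, ← mul_pow]; norm_num [abs_of_nonneg]
    linear_combination (K * |x - y|) * this
  · intro x
    by_cases hx : ∃ i, profileDeriv (ω i) (zoom i x) ≠ 0
    · classical
      -- At the first scale that contributes, the zoomed point lies outside the interior of `J`, so
      -- all later zooms leave `(0,1)`.
      refine ⟨Nat.find hx, fun n hn => ?_⟩
      rcases lt_or_gt_of_ne hn with hlt | hgt
      · rw [not_not.1 (Nat.find_min hx hlt), mul_zero]
      · obtain ⟨m, rfl⟩ := Nat.exists_eq_add_of_lt hgt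
        have hi : zoom (Nat.find hx) x ≤ 1/5 ∨ 2/5 ≤ zoom (Nat.find hx) x := by
          by_contra! hc
          exact Nat.find_spec hx
            (profileDeriv_eq_zero _ (Or.inr (Or.inr ⟨hc.1.le, hc.2.le⟩)))
        have := zoom_escape hi m
        rw [← zoom_add, show m + 1 + Nat.find hx = Nat.find hx + m + 1 by ring] at this
        rw [profileDeriv_eq_zero _ (by tauto), mul_zero]
    · push Not at hx
      exact ⟨0, fun n _ => by rw [hx n, mul_zero]⟩

/-- Away from `J` the sign is visible at scale `0`; inside, zooming multiplies the distance to `1/3`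
by `5`, so finitely many zooms suffice. -/
lemma graphDeriv_mul_pos (ω : ℕ → I) {x : ℝ} (hx : x ∈ Icc (0 : ℝ) 1) (hc : x ≠ 1/3) :
    0 < graphDeriv ω x * (1/3 - x) := by
  have main : ∀ (n : ℕ) (ω : ℕ → I) (x : ℝ), x ∈ Icc (0 : ℝ) 1 → 1 ≤ 5 ^ n * |x - 1/3| →
      0 < graphDeriv ω x * (1/3 - x) := by
    intro n
    induction n with
    | zero =>
      intro ω x hx h
      rw [pow_zero, one_mul, le_abs] at h
      -- Vacuous: no point of `[0,1]` has distance `1` from `1/3`.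
      rcases h with h | h <;> linarith [hx.1, hx.2]
    | succ n ih =>
      intro ω x hx h
      have ht : |(ω 0 : ℝ) * splineDeriv bump x| ≤ 1/200 := by
        rw [abs_mul, abs_of_nonneg (ω 0).2.1]
        exact (mul_le_of_le_one_left (abs_nonneg _) (ω 0).2.2).trans (abs_splineDeriv_bump_le x)
      rw [abs_le] at ht
      rcases le_or_gt x (1/5) with h1 | h1
      · rw [graphDeriv_eq_profileDeriv ω (Or.inl h1), profileDeriv]
        have := splineDeriv_base_left hx.1 h1
        exact mul_pos (by linarith) (by linarith)
      rcases le_or_gt (2/5) x with h2 | h2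
      · rw [graphDeriv_eq_profileDeriv ω (Or.inr h2), profileDeriv]
        have := splineDeriv_base_right h2 hx.2
        exact mul_pos_of_neg_of_neg (by linarith) (by linarith)
      · have hy : 2 - 5 * x ∈ Icc (0 : ℝ) 1 := ⟨by linarith, by linarith⟩
        have e : x = 2/5 - (2 - 5 * x) / 5 := by ring
        have h3 : 1 ≤ 5 ^ n * |2 - 5 * x - 1/3| := by
          rw [show 2 - 5 * x - 1/3 = -5 * (x - 1/3) by ring, abs_mul]
          rw [pow_succ] at h
          norm_num at h ⊢
          linarith
        have := ih (shift ω) (2 - 5 * x) hy h3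
        have hd := graphDeriv_shrink ω hy
        rw [← e] at hd
        rw [hd]
        nlinarith
  have hpos : 0 < |x - 1/3| := abs_pos.2 (sub_ne_zero.2 hc)
  obtain ⟨n, hn⟩ := pow_unbounded_of_one_lt (1 / |x - 1/3|) (by norm_num : (1 : ℝ) < 5)
  exact main n ω x hx ((div_lt_iff₀ hpos).1 hn).le

lemma zoom_one_third (n : ℕ) : zoom n (1/3) = 1/3 := by simp [zoom]

lemma graph_one_third (ω : ℕ → I) : graph ω (1/3) = 1 := by
  have : ∀ n, (1/25 : ℝ) ^ n * profile (ω n) (zoom n (1/3)) = 0 := fun n => by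
    rw [zoom_one_third, profile_eq_zero _ (Or.inr (Or.inr (by norm_num))), mul_zero]
  rw [graph, tsum_congr this, tsum_zero]; norm_num

lemma graphDeriv_one_third (ω : ℕ → I) : graphDeriv ω (1/3) = 0 := by
  have : ∀ n, (-1/5 : ℝ) ^ n * profileDeriv (ω n) (zoom n (1/3)) = 0 := fun n => by
    rw [zoom_one_third, profileDeriv_eq_zero _ (Or.inr (Or.inr (by norm_num))), mul_zero]
  rw [graphDeriv, tsum_congr this, tsum_zero]; norm_num

/-! ### Affine branches and values -/

lemma graph_firstInterval (ω : ℕ → I) {x : ℝ} (h0 : 0 ≤ x) (h1 : x ≤ 3/25) :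
    graph ω x = 3/4 + 3/2 * x := by
  rw [graph_eq_profile ω (Or.inl (by linarith)), profile, spline_bump_of_le (by linarith)]
  simp (disch := grind) only [spline, base, List.map, List.sum_cons, List.sum_nil,
    max_sub_eq_sub, max_sub_eq_zero]
  ring

lemma graph_thirdInterval (ω : ℕ → I) {x : ℝ} (h0 : 3/4 ≤ x) (h1 : x ≤ 93/100) :
    graph ω x = 19/20 - (x - 3/4) / 18 := by
  rw [graph_eq_profile ω (Or.inr (by linarith)), profile, spline_bump_of_le (by linarith)]
  simp (disch := grind) only [spline, base, List.map, List.sum_cons, List.sum_nil,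
    max_sub_eq_sub, max_sub_eq_zero]
  ring

lemma graph_fourthInterval (ω : ℕ → I) {x : ℝ} (h0 : 47/50 ≤ x) (h1 : x ≤ 19/20) :
    graph ω x = 2/5 - 20 * (x - 47/50) := by
  rw [graph_eq_profile ω (Or.inr (by linarith)), profile, spline_bump_of_ge (by linarith)]
  simp (disch := grind) only [spline, base, List.map, List.sum_cons, List.sum_nil,
    max_sub_eq_sub, max_sub_eq_zero]
  ring

lemma graph_fifthInterval (ω : ℕ → I) {x : ℝ} (h0 : 24/25 ≤ x) (h1 : x ≤ 1) :
    graph ω x = 3 * (1 - x) := by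
  rw [graph_eq_profile ω (Or.inr (by linarith)), profile, spline_bump_of_ge (by linarith)]
  simp (disch := grind) only [spline, base, List.map, List.sum_cons, List.sum_nil,
    max_sub_eq_sub, max_sub_eq_zero]
  ring

/-- The midpoint of the bump's support reads off the height `ω 0`. -/
lemma graph_mid_sub (ω η : ℕ → I) :
    graph ω (187/200) - graph η (187/200) = (1/80000) * ((ω 0 : ℝ) - η 0) := by
  have hb : spline bump (187/200) = 1/80000 := by
    simp only [spline, bump, List.map, List.sum_cons, List.sum_nil]
    norm_num
  rw [graph_eq_profile ω (Or.inr (by norm_num)), graph_eq_profile η (Or.inr (by norm_num)),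
    profile, profile, hb]
  ring

lemma graph_mem (ω : ℕ → I) {x : ℝ} (hx : x ∈ Icc (0 : ℝ) 1) : graph ω x ∈ Icc (0 : ℝ) 1 := by
  have hc : Continuous (graph ω) :=
    continuous_iff_continuousAt.2 fun x => (hasDerivAt_graph ω x).continuousAt
  have hl : StrictMonoOn (graph ω) (Icc 0 (1/3)) := by
    refine strictMonoOn_of_deriv_pos (convex_Icc _ _) hc.continuousOn fun y hy => ?_
    rw [interior_Icc] at hy
    rw [(hasDerivAt_graph ω y).deriv]
    exact pos_of_mul_pos_left (graphDeriv_mul_pos ω ⟨hy.1.le, by linarith [hy.2]⟩ hy.2.ne)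
      (by linarith [hy.2])
  have hr : StrictAntiOn (graph ω) (Icc (1/3) 1) := by
    refine strictAntiOn_of_deriv_neg (convex_Icc _ _) hc.continuousOn fun y hy => ?_
    rw [interior_Icc] at hy
    rw [(hasDerivAt_graph ω y).deriv]
    have := graphDeriv_mul_pos ω (x := y) ⟨by linarith [hy.1], hy.2.le⟩ hy.1.ne'
    nlinarith [hy.1]
  rcases le_total x (1/3) with h | h
  · have h1 := hl.monotoneOn ⟨le_rfl, by norm_num⟩ ⟨hx.1, h⟩ hx.1
    have h2 := hl.monotoneOn ⟨hx.1, h⟩ ⟨by norm_num, le_rfl⟩ h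
    rw [graph_firstInterval ω le_rfl (by norm_num)] at h1
    rw [graph_one_third] at h2
    exact ⟨by linarith, h2⟩
  · have h1 := hr.antitoneOn ⟨h, hx.2⟩ ⟨by norm_num, le_rfl⟩ hx.2
    have h2 := hr.antitoneOn ⟨le_rfl, by norm_num⟩ ⟨h, hx.2⟩ h
    rw [graph_fifthInterval ω (by norm_num) le_rfl] at h1
    rw [graph_one_third] at h2
    exact ⟨by linarith, h2⟩

/-! ### Renormalization acts as the shift -/

/-- `graph ω` as a self-map of `[0,1]`. -/
noncomputable def template (ω : ℕ → I) : I → I := fun x => ⟨graph ω x, graph_mem ω x.2⟩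

lemma coe_template (ω : ℕ → I) (x : I) : (template ω x : ℝ) = graph ω x := rfl

lemma hasDerivWithinAt_template (ω : ℕ → I) {x : ℝ} (hx : x ∈ Icc (0 : ℝ) 1) :
    HasDerivWithinAt (IccExtend (zero_le_one (α := ℝ)) fun t => (template ω t : ℝ))
      (graphDeriv ω x) (Icc 0 1) x :=
  (hasDerivAt_graph ω x).hasDerivWithinAt.congr
    (fun y hy => by rw [IccExtend_of_mem _ _ hy, coe_template])
    (by rw [IccExtend_of_mem _ _ hx, coe_template])

lemma slope_template (ω : ℕ → I) (x : I) : slope (template ω) x = graphDeriv ω x :=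
  (hasDerivWithinAt_template ω x.2).derivWithin (uniqueDiffOn_Icc zero_lt_one x x.2)

lemma graph_zero (ω : ℕ → I) : graph ω 0 = 3/4 := by
  rw [graph_firstInterval ω le_rfl (by norm_num)]; norm_num

lemma graph_one (ω : ℕ → I) : graph ω 1 = 0 := by
  rw [graph_fifthInterval ω (by norm_num) le_rfl]; norm_num

lemma isC1LipUnimodal_template (ω : ℕ → I) : IsC1LipUnimodal (template ω) where
  differentiable x hx := (hasDerivWithinAt_template ω hx).differentiableWithinAt
  lipschitz := by
    obtain ⟨K, hK, h⟩ := abs_graphDeriv_sub_le ω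
    refine ⟨⟨K, hK⟩, LipschitzWith.of_dist_le_mul fun x y => ?_⟩
    rw [slope_template, slope_template]
    exact h x y
  critical := by
    refine ⟨⟨1/3, by norm_num, by norm_num⟩, ?_, ?_, Subtype.ext (graph_one_third ω), fun x => ?_⟩
    · rw [← Subtype.coe_lt_coe]; norm_num
    · rw [← Subtype.coe_lt_coe]; norm_num
    · rw [slope_template, Subtype.ext_iff]
      constructor
      · intro h
        by_contra hc
        have := graphDeriv_mul_pos ω x.2 hc
        rw [h, zero_mul] at this
        exact this.false
      · intro h
        rw [h]
        exact graphDeriv_one_third ω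
  map_one := Subtype.ext (graph_one ω)

lemma template_iterate_three (ω : ℕ → I) : ((template ω)^[3] 0 : ℝ) = 1/5 := by
  simp only [iterate_succ_apply', iterate_zero_apply, coe_template, Icc.coe_zero]
  rw [graph_zero, graph_thirdInterval ω le_rfl (by norm_num),
    graph_fourthInterval ω (by norm_num) (by norm_num)]
  norm_num

lemma template_iterate_eight (ω : ℕ → I) : ((template ω)^[8] 0 : ℝ) = 2/5 := by
  rw [show 8 = 5 + 3 by rfl, iterate_add_apply]
  -- The explicit arguments keep the inner third iterate folded, so that its value `1/5` can be
  -- substituted.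
  simp only [iterate_succ_apply' _ 4, iterate_succ_apply' _ 3 ((template ω)^[3] 0),
    iterate_succ_apply' _ 2 ((template ω)^[3] 0), iterate_succ_apply' _ 1 ((template ω)^[3] 0),
    iterate_succ_apply' _ 0 ((template ω)^[3] 0), iterate_zero_apply, coe_template,
    template_iterate_three]
  have h : graph ω (1/5) = 24/25 := by
    have := graph_shrink ω (x := 1) (by norm_num)
    rw [graph_one] at this
    norm_num at this ⊢
    exact this
  have h1 : graph ω (24/25) = 3/25 := by
    rw [graph_fifthInterval ω le_rfl (by norm_num)]; norm_num
  have h2 : graph ω (3/25) = 93/100 := by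
    rw [graph_firstInterval ω (by norm_num) le_rfl]; norm_num
  have h3 : graph ω (93/100) = 47/50 := by
    rw [graph_thirdInterval ω (by norm_num) le_rfl]; norm_num
  rw [h, h1, h2, h3, graph_fourthInterval ω le_rfl (by norm_num)]
  norm_num

lemma mem_returnInterval_template {ω : ℕ → I} {x : I} :
    x ∈ returnInterval (template ω) ↔ (x : ℝ) ∈ Icc (1/5 : ℝ) (2/5) := by
  rw [returnInterval, mem_Icc, mem_Icc, ← Subtype.coe_le_coe, ← Subtype.coe_le_coe,
    template_iterate_three, template_iterate_eight]

/-- After `graph_shrink` the orbit passes only through affine branches, whose composite gives `f⁵ ∘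
h = h ∘ graph (shift ω)`. -/
lemma template_orbit (ω : ℕ → I) {x y : I} (h : (x : ℝ) = 2/5 - y/5) :
    (template ω x : ℝ) = 1 - (1 - graph (shift ω) y) / 25 ∧
    ((template ω)^[2] x : ℝ) = 3 * (1 - graph (shift ω) y) / 25 ∧
    ((template ω)^[3] x : ℝ) = 3/4 + 9 * (1 - graph (shift ω) y) / 50 ∧
    ((template ω)^[4] x : ℝ) = 19/20 - (1 - graph (shift ω) y) / 100 ∧
    ((template ω)^[5] x : ℝ) = 2/5 - graph (shift ω) y / 5 := by
  obtain ⟨g0, g1⟩ := graph_mem (shift ω) y.2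
  have h1 : (template ω x : ℝ) = 1 - (1 - graph (shift ω) y) / 25 := by
    rw [coe_template, h, graph_shrink ω y.2]
  have h2 : ((template ω)^[2] x : ℝ) = 3 * (1 - graph (shift ω) y) / 25 := by
    rw [iterate_succ_apply', coe_template, iterate_one, h1,
      graph_fifthInterval ω (by linarith) (by linarith)]
    ring
  have h3 : ((template ω)^[3] x : ℝ) = 3/4 + 9 * (1 - graph (shift ω) y) / 50 := by
    rw [iterate_succ_apply', coe_template, h2,
      graph_firstInterval ω (by linarith) (by linarith)]
    ring
  have h4 : ((template ω)^[4] x : ℝ) = 19/20 - (1 - graph (shift ω) y) / 100 := by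
    rw [iterate_succ_apply', coe_template, h3,
      graph_thirdInterval ω (by linarith) (by linarith)]
    ring
  refine ⟨h1, h2, h3, h4, ?_⟩
  rw [iterate_succ_apply', coe_template, h4,
    graph_fourthInterval ω (by linarith) (by linarith)]
  ring

lemma template_orbit_mem (ω : ℕ → I) {x : I} (hx : x ∈ returnInterval (template ω)) :
    (template ω x : ℝ) ∈ Icc (24/25 : ℝ) 1 ∧ ((template ω)^[2] x : ℝ) ∈ Icc (0 : ℝ) (3/25) ∧
    ((template ω)^[3] x : ℝ) ∈ Icc (3/4 : ℝ) (93/100) ∧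
    ((template ω)^[4] x : ℝ) ∈ Icc (47/50 : ℝ) (19/20) ∧
    ((template ω)^[5] x : ℝ) ∈ Icc (1/5 : ℝ) (2/5) := by
  obtain ⟨a, b⟩ := mem_returnInterval_template.1 hx
  let y : I := ⟨2 - 5 * x, by linarith, by linarith⟩
  obtain ⟨h1, h2, h3, h4, h5⟩ := template_orbit ω (x := x) (y := y) (by simp only [y]; ring)
  obtain ⟨g0, g1⟩ := graph_mem (shift ω) y.2
  rw [h1, h2, h3, h4, h5]
  refine ⟨⟨?_, ?_⟩, ⟨?_, ?_⟩, ⟨?_, ?_⟩, ⟨?_, ?_⟩, ⟨?_, ?_⟩⟩ <;> linarith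

lemma isQuintRenormalizable_template (ω : ℕ → I) : IsQuintRenormalizable (template ω) where
  nondegenerate := by
    rw [← Subtype.coe_lt_coe, template_iterate_three, template_iterate_eight]; norm_num
  critical_mem := by
    refine ⟨⟨1/3, by norm_num, by norm_num⟩, ⟨?_, ?_⟩, ?_⟩
    · rw [← Subtype.coe_lt_coe, template_iterate_three]; norm_num
    · rw [← Subtype.coe_lt_coe, template_iterate_eight]; norm_num
    · rw [slope_template]; exact graphDeriv_one_third ω
  mapsTo x hx := mem_returnInterval_template.2 (template_orbit_mem ω hx).2.2.2.2
  order₁₂ := by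
    rintro _ ⟨x, hx, rfl⟩ y hy
    have h1 := (template_orbit_mem ω hx).2.1.2
    have h2 := (mem_returnInterval_template.1 hy).1
    rw [← Subtype.coe_lt_coe]; linarith
  order₂₃ := by
    rintro y hy _ ⟨x, hx, rfl⟩
    have h1 := (template_orbit_mem ω hx).2.2.1.1
    have h2 := (mem_returnInterval_template.1 hy).2
    rw [← Subtype.coe_lt_coe]; linarith
  order₃₄ := by
    rintro _ ⟨x, hx, rfl⟩ _ ⟨y, hy, rfl⟩
    have h1 := (template_orbit_mem ω hx).2.2.1.2
    have h2 := (template_orbit_mem ω hy).2.2.2.1.1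
    rw [← Subtype.coe_lt_coe]; linarith
  order₄₅ := by
    rintro _ ⟨x, hx, rfl⟩ _ ⟨y, hy, rfl⟩
    have h1 := (template_orbit_mem ω hx).2.2.2.1.2
    have h2 := (template_orbit_mem ω hy).1.1
    rw [← Subtype.coe_lt_coe]; linarith

lemma renormalize_template (ω : ℕ → I) : renormalize (template ω) = template (shift ω) := by
  ext y
  have hs : rescale (template ω) y = 2/5 - y/5 := by
    rw [rescale, template_iterate_three, template_iterate_eight]; ring
  have hm : (2/5 - y/5 : ℝ) ∈ Icc (0 : ℝ) 1 := ⟨by linarith [y.2.2], by linarith [y.2.1]⟩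
  obtain ⟨-, -, -, -, h5⟩ := template_orbit ω (x := ⟨2/5 - y/5, hm⟩) (y := y) rfl
  rw [renormalize, hs, projIcc_of_mem zero_le_one hm, h5, unscale, template_iterate_three,
    template_iterate_eight, show (2/5 - (2/5 - graph (shift ω) y / 5)) / (2/5 - 1/5) =
      graph (shift ω) y by ring, projIcc_of_mem zero_le_one (graph_mem (shift ω) y.2),
    coe_template]

lemma renormalize_iterate_template (ω : ℕ → I) (n : ℕ) :
    renormalize^[n] (template ω) = template (shift^[n] ω) :=
  (Semiconj.iterate_right (f := template) (ga := shift) (gb := renormalize)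
    (fun ω => (renormalize_template ω).symm) n ω).symm

/-! ### Embedding the shift -/

/-- The infinitely renormalizable map with the sequence `ω` of bump heights. -/
noncomputable def ofSeq (ω : ℕ → I) : InfRenormalizable :=
  ⟨⟨template ω, isC1LipUnimodal_template ω⟩, fun n => by
    rw [renormalize_iterate_template]
    exact ⟨isC1LipUnimodal_template _, isQuintRenormalizable_template _⟩⟩

lemma renorm_ofSeq (ω : ℕ → I) : renorm (ofSeq ω) = ofSeq (shift ω) :=
  Subtype.ext (UnimodalMap.ext (renormalize_template ω))

lemma renorm_iterate_ofSeq (ω : ℕ → I) (n : ℕ) : renorm^[n] (ofSeq ω) = ofSeq (shift^[n] ω) :=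
  (Semiconj.iterate_right (f := ofSeq) (ga := shift) (gb := renorm)
    (fun ω => (renorm_ofSeq ω).symm) n ω).symm

lemma isInducing_jet : Topology.IsInducing UnimodalMap.jet := ⟨rfl⟩

lemma continuous_ofSeq : Continuous ofSeq := by
  refine Continuous.subtype_mk (isInducing_jet.continuous_iff.2 (Continuous.prodMk ?_ ?_)) _
  · refine ContinuousMap.continuous_of_continuous_uncurry _ ?_
    exact continuous_graph.comp (continuous_fst.prodMk (continuous_subtype_val.comp continuous_snd))
  · refine ContinuousMap.continuous_of_continuous_uncurry _ ?_
    refine (continuous_graphDeriv.comp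
      (continuous_fst.prodMk (continuous_subtype_val.comp continuous_snd))).congr fun p => ?_
    exact (slope_template p.1 p.2).symm

lemma abs_sub_le_dist_ofSeq (ω η : ℕ → I) :
    (1/80000) * |(ω 0 : ℝ) - η 0| ≤ dist (ofSeq ω) (ofSeq η) := by
  have h1 : dist (ofSeq ω).1.jet.1 (ofSeq η).1.jet.1 ≤ dist (ofSeq ω) (ofSeq η) :=
    le_max_left _ _
  refine le_trans (le_of_eq ?_)
    ((ContinuousMap.dist_apply_le_dist (⟨187/200, by norm_num, by norm_num⟩ : I)).trans h1)
  have : dist (graph ω (187/200)) (graph η (187/200)) = (1/80000) * |(ω 0 : ℝ) - η 0| := by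
    rw [Real.dist_eq, graph_mid_sub, abs_mul]; norm_num
  exact this.symm

lemma shift_iterate_apply (n k : ℕ) (ω : ℕ → I) : shift^[n] ω k = ω (k + n) := by
  induction n generalizing ω with
  | zero => rfl
  | succ n ih => rw [iterate_succ_apply, ih, shift, Nat.add_assoc]

/-! ### Infinite entropy -/

/-- The sequence of bump heights coded by a word in `N + 1` letters. -/
noncomputable def wordSeq {N n : ℕ} (w : Fin n → Fin (N + 1)) : ℕ → I := fun k =>
  if h : k < n then ⟨(w ⟨k, h⟩ : ℝ) / (N + 1), by positivity,
    div_le_one_of_le₀ (by exact_mod_cast (w ⟨k, h⟩).2.le) (by positivity)⟩ else 0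

/-- Renormalizing `k` times moves the `k`-th letter to position `0`, where it is read off; distinct
letters differ in height by at least `1/(N+1)`. -/
lemma dist_iterate_ofSeq_wordSeq {N n : ℕ} {v w : Fin n → Fin (N + 1)} (hvw : v ≠ w) :
    ∃ k < n, (1/80000) / (N + 1 : ℝ) ≤
      dist (renorm^[k] (ofSeq (wordSeq v))) (renorm^[k] (ofSeq (wordSeq w))) := by
  obtain ⟨k, hk⟩ := ne_iff.1 hvw
  refine ⟨k, k.2, ?_⟩
  rw [renorm_iterate_ofSeq, renorm_iterate_ofSeq]
  refine le_trans ?_ (abs_sub_le_dist_ofSeq _ _)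
  rw [shift_iterate_apply, shift_iterate_apply, zero_add, wordSeq, wordSeq, dif_pos k.2,
    dif_pos k.2]
  simp only [Fin.eta]
  have h1 : (1 : ℝ) ≤ |(v k : ℝ) - w k| := by
    have : (1 : ℤ) ≤ |(v k : ℤ) - (w k : ℤ)| :=
      Int.one_le_abs (sub_ne_zero.2 (by exact_mod_cast fun h => hk (Fin.ext h)))
    exact_mod_cast this
  rw [← sub_div, abs_div, abs_of_pos (by positivity : (0 : ℝ) < N + 1), ← mul_div_assoc]
  gcongr
  linarith

/-- The `(N+1)^n` words of length `n` give a dynamical net at a scale independent of `n`. -/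
lemma log_le_coverEntropy (N : ℕ) :
    ENNReal.log (N + 1 : ℕ) ≤ Dynamics.coverEntropy renorm (range ofSeq) := by
  classical
  set ε : ℝ := (1/80000) / (N + 1 : ℝ) with hε
  have hpos : 0 < ε := by positivity
  -- Nets ask for disjoint dynamical balls, hence half the separation.
  set U : Set (InfRenormalizable × InfRenormalizable) := {p | dist p.1 p.2 < ε / 2} with hU
  refine le_trans ?_ (Dynamics.netEntropyEntourage_le_coverEntropy (U := U) (T := renorm)
    (F := range ofSeq) (Metric.dist_mem_uniformity (half_pos hpos)))
  rw [← ExpGrowth.expGrowthSup_pow, Dynamics.netEntropyEntourage]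
  refine ExpGrowth.expGrowthSup_monotone fun n => ?_
  have hne : ∀ v w : Fin n → Fin (N + 1), v ≠ w →
      Disjoint (UniformSpace.ball (ofSeq (wordSeq v)) (Dynamics.dynEntourage renorm U n))
        (UniformSpace.ball (ofSeq (wordSeq w)) (Dynamics.dynEntourage renorm U n)) := by
    intro v w hvw
    obtain ⟨k, hk, hd⟩ := dist_iterate_ofSeq_wordSeq hvw
    rw [Set.disjoint_left]
    intro z hv hw
    have h1 := Dynamics.mem_ball_dynEntourage.1 hv k hk
    have h2 := Dynamics.mem_ball_dynEntourage.1 hw k hk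
    have h1' : dist (renorm^[k] (ofSeq (wordSeq v))) (renorm^[k] z) < ε / 2 := h1
    have h2' : dist (renorm^[k] (ofSeq (wordSeq w))) (renorm^[k] z) < ε / 2 := h2
    have := dist_triangle_right (renorm^[k] (ofSeq (wordSeq v)))
      (renorm^[k] (ofSeq (wordSeq w))) (renorm^[k] z)
    linarith
  have hinj : Injective fun v : Fin n → Fin (N + 1) => ofSeq (wordSeq v) := by
    intro v w h
    by_contra hvw
    obtain ⟨k, -, hd⟩ := dist_iterate_ofSeq_wordSeq hvw
    simp only at h
    rw [h, dist_self] at hd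
    linarith
  have hnet : Dynamics.IsDynNetIn renorm (range ofSeq) U n
      (Finset.univ.image fun v : Fin n → Fin (N + 1) => ofSeq (wordSeq v) :
        Finset InfRenormalizable) := by
    refine ⟨?_, ?_⟩
    · intro z hz
      obtain ⟨v, -, rfl⟩ := Finset.mem_image.1 (Finset.mem_coe.1 hz)
      exact mem_range_self _
    · intro a ha b hb hab
      obtain ⟨v, -, rfl⟩ := Finset.mem_image.1 (Finset.mem_coe.1 ha)
      obtain ⟨w, -, rfl⟩ := Finset.mem_image.1 (Finset.mem_coe.1 hb)
      exact hne v w fun h => hab (by rw [h])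
  have hcard := hnet.card_le_netMaxcard
  rw [Finset.card_image_of_injective _ hinj, Finset.card_univ, Fintype.card_fun,
    Fintype.card_fin, Fintype.card_fin] at hcard
  have := ENat.toENNReal_mono hcard
  simpa using this

lemma renormEntropy_eq_top : renormEntropy = ⊤ := by
  have hle : Dynamics.coverEntropy renorm (range ofSeq) ≤ renormEntropy := by
    refine le_iSup_of_le (range ofSeq) (le_iSup_of_le (isCompact_range continuous_ofSeq)
      (le_iSup_of_le ?_ le_rfl))
    rintro _ ⟨ω, rfl⟩
    exact ⟨shift ω, (renorm_ofSeq ω).symm⟩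
  have hlim : Filter.Tendsto (fun N : ℕ => ENNReal.log ((N + 1 : ℕ) : ENNReal)) Filter.atTop
      (nhds ⊤) := by
    have h := (ENNReal.tendsto_nat_nhds_top.comp (Filter.tendsto_add_atTop_nat 1))
    have := (ENNReal.continuous_log.tendsto ⊤).comp h
    rwa [ENNReal.log_top] at this
  exact top_le_iff.1 (le_of_tendsto' hlim fun N => (log_le_coverEntropy N).trans hle)

/-! ### The continuum of fixed points -/

lemma ofSeq_const_injective : Injective fun t : I => ofSeq fun _ => t := by
  intro s t h
  have := abs_sub_le_dist_ofSeq (fun _ => s) (fun _ => t)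
  simp only at h
  rw [h, dist_self] at this
  have h0 : |(s : ℝ) - t| = 0 := le_antisymm (by linarith) (abs_nonneg _)
  exact Subtype.ext (sub_eq_zero.1 (abs_eq_zero.1 h0))

lemma renorm_ofSeq_const (t : I) : renorm (ofSeq fun _ => t) = ofSeq fun _ => t :=
  renorm_ofSeq _

/-- A continuous map is determined by its values on a dense sequence, and `𝔠 ^ ℵ₀ = 𝔠`. -/
lemma mk_infRenormalizable_le : #InfRenormalizable ≤ 𝔠 := by
  have hinj : Injective fun (f : InfRenormalizable) (n : ℕ) =>
      f.1.jet.1 (TopologicalSpace.denseSeq I n) := by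
    intro f g h
    have h1 : (f.1.jet.1 : I → ℝ) = g.1.jet.1 :=
      (TopologicalSpace.denseRange_denseSeq I).equalizer f.1.jet.1.continuous
        g.1.jet.1.continuous h
    refine Subtype.ext (UnimodalMap.ext (funext fun x => Subtype.ext ?_))
    exact congrFun h1 x
  refine (Cardinal.mk_le_of_injective hinj).trans ?_
  simp [Cardinal.mk_real]

lemma mk_fixedPoints_renorm : #(fixedPoints renorm) = 𝔠 := by
  refine le_antisymm ((Cardinal.mk_subtype_le _).trans mk_infRenormalizable_le) ?_
  have hI : #I = 𝔠 := Cardinal.mk_Icc_real zero_lt_one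
  rw [← hI]
  exact Cardinal.mk_le_of_injective
    (f := fun t : I => (⟨ofSeq fun _ => t, renorm_ofSeq_const t⟩ : fixedPoints renorm))
    fun s t h => ofSeq_const_injective (congrArg Subtype.val h)

end Quintupling

theorem mainTheorem8 :
    Quintupling.renormEntropy = ⊤ ∧
    #(Function.fixedPoints Quintupling.renorm) = 𝔠 ∧
    ∃ γ : I → Quintupling.InfRenormalizable,
      Continuous γ ∧ Function.Injective γ ∧ ∀ t, Quintupling.renorm (γ t) = γ t :=
  ⟨Quintupling.renormEntropy_eq_top, Quintupling.mk_fixedPoints_renorm,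
    fun t => Quintupling.ofSeq fun _ => t,
    Quintupling.continuous_ofSeq.comp (continuous_pi fun _ => continuous_id),
    Quintupling.ofSeq_const_injective, Quintupling.renorm_ofSeq_const⟩
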